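/- Let $d\ge 1$ and let $p=(p_1,\dots,p_d)$ be a probability distribution (zero entries allowed) that is not uniform. Put $|\varphi\rangle=\sum_{i=1}^d\sqrt{p_i}\,|i\rangle\in\mathbb C^d$. For $n\ge 1$, let $\{|J\rangle\}_{J\in\{1,\dots,d\}^n}$ be the product basis of $(\mathbb C^d)^{\otimes n}$, and for $L=(L_J)_J\in\mathbb Z_2^{d^n}$ let $|\phi^n_L\rangle=d^{-n/2}\sum_J(-1)^{L_J}|J\rangle$. For an operator $S$ on $(\mathbb C^d)^{\otimes n}$ with $0\le S\le I$ put $$\alpha_n(S)=\operatorname{Tr} S\,|\varphi\rangle\langle\varphi|^{\otimes n},\qquad \beta_n(S)=\max_{L\in\mathbb Z_2^{d^n}}\operatorname{Tr}(I-S)\,|\phi^n_L\rangle\langle\phi^n_L|,$$ and for $\alpha\ge 0$ put $\beta_n(\alpha|\varphi)=\min\{\beta_n(S): 0\le S\le I,\ \alpha_n(S)\le\alpha\}$. For $\alpha>0$, $\alpha\ne 1$ let $H_\alpha(p)=\frac{1}{1-\alpha}\log\sum_i p_i^{\alpha}$ be the Rényi entropy. Then for every $r>0$, $\beta_n(e^{-nr}|\varphi)>0$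 for all $n\ge1$, the minimum below is attained, and, as $n\to\infty$, $$\log\beta_n(e^{-nr}|\varphi)=n\Bigl(2\min_{0\le s<1}\Bigl[\frac{s}{1-s}\,r+\frac12 H_{\frac{1+s}{2}}(p)\Bigr]-\log d\Bigr)+o(n).$$ -/

import Mathlib

open Filter Asymptotics
open scoped ComplexOrder

noncomputable section

namespace CompositeTest

/-- The index set `𝒟ⁿ = {1, …, d}ⁿ` of the product basis `|J⟩ = |i₁⟩ ⊗ ⋯ ⊗ |iₙ⟩` of `(ℂᵈ)^{⊗n}`.
Vectors and operators on `(ℂᵈ)^{⊗n}` are written in this basis. -/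
abbrev Idx (d n : ℕ) : Type := Fin n → Fin d

/-- The operators on `(ℂᵈ)^{⊗n}`. -/
abbrev Op (d n : ℕ) : Type := Matrix (Idx d n) (Idx d n) ℂ

/-- The vector `|φ⟩ = ∑ᵢ √pᵢ |i⟩` of `ℂᵈ`. -/
def phi {d : ℕ} (p : Fin d → ℝ) : Fin d → ℂ := fun i => ((Real.sqrt (p i) : ℝ) : ℂ)

/-- The tensor power `v^{⊗n}`: its `J`-th coordinate is `∏ₖ v_{iₖ}`. -/
def tensorPow {d : ℕ} (n : ℕ) (v : Fin d → ℂ) : Idx d n → ℂ := fun J => ∏ k, v (J k)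

/-- The rank-one operator `|v⟩⟨v|`. -/
def ketBra {ι : Type*} (v : ι → ℂ) : Matrix ι ι ℂ := Matrix.vecMulVec v (star v)

/-- The vector `|φ_Lⁿ⟩ = d^{-n/2} ∑_J (-1)^{L_J} |J⟩`, for `L ∈ ℤ₂^{dⁿ}`. -/
def phiL (d n : ℕ) (L : Idx d n → ZMod 2) : Idx d n → ℂ :=
  fun J => ((Real.sqrt (1 / (d : ℝ) ^ n) : ℝ) : ℂ) * (-1) ^ (L J).val

/-- `0 ≤ S ≤ I`, that is, `{S, I - S}` is a two-valued POVM. -/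
def IsTest {d n : ℕ} (S : Op d n) : Prop := S.PosSemidef ∧ (1 - S).PosSemidef

/-- Type-1 error `Tr S |φ⟩⟨φ|^{⊗n}` (the trace is real for every test `S`). -/
def typeOneError {d n : ℕ} (p : Fin d → ℝ) (S : Op d n) : ℝ :=
  (S * ketBra (tensorPow n (phi p))).trace.re

/-- Type-2 error `max_L Tr (I - S) |φ_Lⁿ⟩⟨φ_Lⁿ|` of the composite alternative. -/
def typeTwoError {d n : ℕ} (S : Op d n) : ℝ :=
  Finset.univ.sup' Finset.univ_nonempty
    (fun L : Idx d n → ZMod 2 => ((1 - S) * ketBra (phiL d n L)).trace.re)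

/-- The type-2 errors of the tests whose type-1 error is at most `α`. -/
def feasibleErrors {d : ℕ} (p : Fin d → ℝ) (n : ℕ) (α : ℝ) : Set ℝ :=
  {b | ∃ S : Op d n, IsTest S ∧ typeOneError p S ≤ α ∧ typeTwoError S = b}

/-- The optimal type-2 error `βₙ(α|φ)`. The infimum is a minimum for `α ≥ 0`
(see `isLeast_optTypeTwoError`). -/
def optTypeTwoError {d : ℕ} (p : Fin d → ℝ) (n : ℕ) (α : ℝ) : ℝ :=
  sInf (feasibleErrors p n α)

/-- The Rényi entropy `H_α(p) = (1 - α)⁻¹ log ∑ᵢ pᵢ^α` of order `α > 0`, `α ≠ 1`. -/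
def renyiEntropy {d : ℕ} (α : ℝ) (p : Fin d → ℝ) : ℝ :=
  Real.log (∑ i, p i ^ α) / (1 - α)

/-- The function of `s` that is minimised: `s r / (1 - s) + ½ H_{(1+s)/2}(p)`. -/
def exponentFun {d : ℕ} (p : Fin d → ℝ) (r s : ℝ) : ℝ :=
  s / (1 - s) * r + 1 / 2 * renyiEntropy ((1 + s) / 2) p

section Attained

open scoped Matrix.Norms.L2Operator MatrixOrder

theorem isCompact_isTest (d n : ℕ) : IsCompact {S : Op d n | IsTest S} := by
  have hset : {S : Op d n | IsTest S} = Set.Icc (0 : Op d n) 1 := by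
    ext S
    simp [IsTest, Set.mem_Icc, Matrix.le_iff]
  rw [hset]
  refine Metric.isCompact_of_isClosed_isBounded ?_ ?_
  · exact isClosed_Icc
  · refine (Metric.isBounded_closedBall (x := (0 : Op d n)) (r := 1)).subset ?_
    intro S hS
    rw [mem_closedBall_zero_iff]
    exact (CStarAlgebra.norm_le_one_iff_of_nonneg S hS.1).2 hS.2

end Attained

theorem isLeast_optTypeTwoError {d : ℕ} (p : Fin d → ℝ) (n : ℕ) {α : ℝ} (hα : 0 ≤ α) :
    IsLeast (feasibleErrors p n α) (optTypeTwoError p n α) := by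
  have h1 : Continuous (fun S : Op d n => typeOneError p S) := by
    unfold typeOneError; fun_prop
  have h2 : Continuous (fun S : Op d n => typeTwoError S) := by
    unfold typeTwoError
    refine Continuous.finset_sup'_apply _ fun L _ => ?_
    fun_prop
  have hK : IsCompact ({S : Op d n | IsTest S} ∩ {S | typeOneError p S ≤ α}) :=
    (isCompact_isTest d n).inter_right (isClosed_le h1 continuous_const)
  have himg : feasibleErrors p n α =
      typeTwoError '' ({S : Op d n | IsTest S} ∩ {S | typeOneError p S ≤ α}) := by
    ext b
    simp [feasibleErrors, and_assoc]
  have hne : ({S : Op d n | IsTest S} ∩ {S | typeOneError p S ≤ α}).Nonempty :=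
    ⟨0, ⟨Matrix.PosSemidef.zero, by simpa using Matrix.PosSemidef.one⟩,
      by simpa [typeOneError] using hα⟩
  unfold optTypeTwoError
  rw [himg]
  exact (hK.image h2).isLeast_sInf (hne.image _)

end CompositeTest

end

noncomputable section

namespace CompositeTest

open Matrix Topology

/-! ### Reduction to real quadratic forms -/

/-! All vectors involved have real coordinates, so a test enters only through the quadratic form of
its real part. Maximising an overlap with a real vector `v` over all sign patterns gives `d^{-n/2}
‖v‖₁`. The problem thus becomes: how small can the `ℓ¹` norm of a vector be when it is close to `ψ =
|φ⟩^{⊗n}`? Write `Λ(s) = log ∑ pᵢ^{(1+s)/2}`; then `exponentFun` is `f(s) = (s r + Λ(s)) / (1 - s)`.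

Upper bound (`optTypeTwoError_le_exp`): project onto `ψ` truncated to the words of probability at
least `e^{-na}`. Exponential Markov bounds with parameter `s` control both the discarded probability
and the `ℓ¹` norm of what is kept; choosing `a` so that the former is `e^{-nr}` makes the latter
`e^{n f(s)}`.

Lower bound (`eventually_le_log_optTypeTwoError`): a test yields a vector within squared distance
`2α` of `ψ`, so it cannot remove a set of words whose probability is well above `α`. Take the words
typical for the tilted law `∝ pᵢ^{(1+s)/2}`: if `a(s)` is their surprisal rate and `D(s)` the
divergence from `p`, the set has probability about `e^{-n D(s)}`, which is admissible when `D(s) <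
r`, and gives exponent `a(s) - 2 D(s) - log d`.

The bounds meet because `a - 2D = 2f - 2 (s/(1-s)) (r - D)` (`tiltedSurprisal_sub_two_mul`): the
correction vanishes at `s = 0` and wherever `D(s) = r`. `exists_tiltedDivergence_lt` finds a
suitable `s` by continuity alone, with no differentiation of `f`. -/

lemma trace_mul_ketBra_re {ι : Type*} [Fintype ι] (S : Matrix ι ι ℂ) (x : ι → ℝ) :
    (S * ketBra (fun i => (x i : ℂ))).trace.re = x ⬝ᵥ (S.map Complex.re *ᵥ x) := by
  simp only [Matrix.trace, Matrix.diag, Matrix.mul_apply, ketBra, vecMulVec_apply, dotProduct,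
    mulVec, Finset.mul_sum, Complex.re_sum, Pi.star_apply, Matrix.map_apply]
  refine Finset.sum_congr rfl fun i _ => Finset.sum_congr rfl fun j _ => ?_
  simp [Complex.mul_re, Complex.mul_im]
  ring

lemma dotProduct_map_re_mulVec_nonneg {ι : Type*} [Fintype ι] {S : Matrix ι ι ℂ}
    (hS : S.PosSemidef) (x : ι → ℝ) : 0 ≤ x ⬝ᵥ (S.map Complex.re *ᵥ x) := by
  have h := hS.dotProduct_mulVec_nonneg (fun i => (x i : ℂ))
  have h' := (Complex.le_def.1 h).1
  refine h'.trans_eq ?_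
  simp [dotProduct, mulVec, Finset.mul_sum, Complex.mul_re, Complex.mul_im]

lemma map_re_dotProduct_mulVec_comm {ι : Type*} [Fintype ι] {S : Matrix ι ι ℂ}
    (hS : S.IsHermitian) (x y : ι → ℝ) :
    x ⬝ᵥ (S.map Complex.re *ᵥ y) = y ⬝ᵥ (S.map Complex.re *ᵥ x) := by
  have hT : (S.map Complex.re)ᵀ = S.map Complex.re := by
    ext i j
    have := congrArg Complex.re (hS.apply i j)
    simpa using this
  rw [dotProduct_mulVec, ← mulVec_transpose, hT, dotProduct_comm]

lemma one_sub_map_re {ι : Type*} [Fintype ι] [DecidableEq ι] (S : Matrix ι ι ℂ) :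
    (1 - S).map Complex.re = 1 - S.map Complex.re := by
  ext i j
  by_cases h : i = j <;> simp [h]

lemma dotProduct_ketBra_map_re_mulVec {ι : Type*} [Fintype ι] (w x : ι → ℝ) :
    x ⬝ᵥ ((ketBra (fun i => (w i : ℂ))).map Complex.re *ᵥ x) = (w ⬝ᵥ x) ^ 2 := by
  have : (ketBra (fun i => (w i : ℂ))).map Complex.re = vecMulVec w w := by
    ext i j
    simp [ketBra, vecMulVec_apply]
  rw [this, vecMulVec_mulVec]
  simp [dotProduct_smul, dotProduct_comm x w, sq]

/-! ### Amplitudes and weights of the null hypothesis -/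

/-- The coordinates of `|φ⟩^{⊗n}`. -/
def amplitude {d : ℕ} (p : Fin d → ℝ) (n : ℕ) (J : Idx d n) : ℝ := ∏ k, Real.sqrt (p (J k))

/-- The probability of the word `J` under the product distribution `pⁿ`. -/
def weight {d : ℕ} (p : Fin d → ℝ) {n : ℕ} (J : Idx d n) : ℝ := ∏ k, p (J k)

/-- The real coordinates of `|φ_Lⁿ⟩`. -/
def signVec (d n : ℕ) (L : Idx d n → ZMod 2) (J : Idx d n) : ℝ :=
  Real.sqrt (1 / (d : ℝ) ^ n) * (-1) ^ (L J).val

section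

variable {d n : ℕ} {p : Fin d → ℝ}

lemma tensorPow_phi (p : Fin d → ℝ) (n : ℕ) :
    tensorPow n (phi p) = fun J => ((amplitude p n J : ℝ) : ℂ) := by
  ext J
  simp [tensorPow, phi, amplitude]

lemma phiL_eq (L : Idx d n → ZMod 2) : phiL d n L = fun J => ((signVec d n L J : ℝ) : ℂ) := by
  ext J
  simp [phiL, signVec]

lemma amplitude_nonneg (J : Idx d n) : 0 ≤ amplitude p n J :=
  Finset.prod_nonneg fun _ _ => Real.sqrt_nonneg _

lemma amplitude_sq (hp0 : ∀ i, 0 ≤ p i) (J : Idx d n) : amplitude p n J ^ 2 = weight p J := by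
  simp [amplitude, weight, ← Finset.prod_pow, Real.sq_sqrt, hp0]

lemma weight_nonneg (hp0 : ∀ i, 0 ≤ p i) (J : Idx d n) : 0 ≤ weight p J :=
  Finset.prod_nonneg fun _ _ => hp0 _

lemma sum_weight (p : Fin d → ℝ) (n : ℕ) : ∑ J : Idx d n, weight p J = (∑ i, p i) ^ n :=
  (Fintype.sum_pow p n).symm

lemma amplitude_dotProduct_self (hp0 : ∀ i, 0 ≤ p i) (hp1 : ∑ i, p i = 1) :
    amplitude p n ⬝ᵥ amplitude p n = 1 := by
  simp only [dotProduct, ← sq, amplitude_sq hp0, sum_weight, hp1, one_pow]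

lemma typeOneError_eq (S : Op d n) :
    typeOneError p S = amplitude p n ⬝ᵥ (S.map Complex.re *ᵥ amplitude p n) := by
  rw [typeOneError, tensorPow_phi, trace_mul_ketBra_re]

lemma signVec_dotProduct_le_typeTwoError (S : Op d n) (L : Idx d n → ZMod 2) :
    signVec d n L ⬝ᵥ ((1 - S).map Complex.re *ᵥ signVec d n L) ≤ typeTwoError S := by
  rw [← trace_mul_ketBra_re, ← phiL_eq]
  exact Finset.le_sup' (fun L : Idx d n → ZMod 2 => ((1 - S) * ketBra (phiL d n L)).trace.re)
    (Finset.mem_univ L)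

lemma exists_signVec_dotProduct_eq (v : Idx d n → ℝ) :
    ∃ L, signVec d n L ⬝ᵥ v = Real.sqrt (1 / (d : ℝ) ^ n) * ∑ J, |v J| := by
  refine ⟨fun J => if v J < 0 then 1 else 0, ?_⟩
  rw [dotProduct, Finset.mul_sum]
  refine Finset.sum_congr rfl fun J _ => ?_
  rw [signVec, mul_assoc]
  congr 1
  by_cases h : v J < 0
  · simp [h, abs_of_neg h, ZMod.val_one]
  · simp [h, abs_of_nonneg (not_lt.1 h)]

lemma abs_signVec_dotProduct_le (L : Idx d n → ZMod 2) (v : Idx d n → ℝ) :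
    |signVec d n L ⬝ᵥ v| ≤ Real.sqrt (1 / (d : ℝ) ^ n) * ∑ J, |v J| := by
  rw [dotProduct, Finset.mul_sum]
  refine (Finset.abs_sum_le_sum_abs _ _).trans (Finset.sum_le_sum fun J _ => ?_)
  rw [signVec, abs_mul, abs_mul, abs_of_nonneg (Real.sqrt_nonneg _)]
  simp

/-! ### Lower bounds on the type-2 error -/

/-- A test of type-1 error at most `α` yields a real vector in the unit ball, close to `|φ⟩^{⊗n}`,
whose `ℓ¹` norm is controlled by the type-2 error. -/
lemma exists_vector_of_isTest (hp0 : ∀ i, 0 ≤ p i) (hp1 : ∑ i, p i = 1) (hd : 0 < d)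
    {α : ℝ} (hα : α < 1) {S : Op d n} (hS : IsTest S) (hSα : typeOneError p S ≤ α) :
    ∃ v : Idx d n → ℝ, v ⬝ᵥ v ≤ 1 ∧ Real.sqrt (1 - α) ≤ v ⬝ᵥ amplitude p n ∧
      (∑ J, |v J|) ^ 2 ≤ (d : ℝ) ^ n * typeTwoError S := by
  set ψ := amplitude p n with hψ
  set R : Matrix (Idx d n) (Idx d n) ℝ := (1 - S).map Complex.re with hR
  have hsymm : ∀ x y, x ⬝ᵥ (R *ᵥ y) = y ⬝ᵥ (R *ᵥ x) :=
    map_re_dotProduct_mulVec_comm hS.2.isHermitian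
  have hnonneg : ∀ x, 0 ≤ x ⬝ᵥ (R *ᵥ x) := dotProduct_map_re_mulVec_nonneg hS.2
  have hle : ∀ x, x ⬝ᵥ (R *ᵥ x) ≤ x ⬝ᵥ x := by
    intro x
    have := dotProduct_map_re_mulVec_nonneg hS.1 x
    rw [hR, one_sub_map_re, sub_mulVec, one_mulVec, dotProduct_sub]
    linarith
  set u := R *ᵥ ψ with hu
  set c := ψ ⬝ᵥ u with hc
  have hcα : 1 - α ≤ c := by
    have : c = 1 - typeOneError p S := by
      rw [hc, hu, hR, one_sub_map_re, sub_mulVec, one_mulVec, dotProduct_sub, typeOneError_eq,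
        hψ, amplitude_dotProduct_self hp0 hp1]
    linarith
  have hc0 : 0 < c := by linarith
  have hsc : 0 < Real.sqrt c := Real.sqrt_pos.2 hc0
  have hsq : Real.sqrt c ^ 2 = c := Real.sq_sqrt hc0.le
  -- This is `R² ≤ R`, obtained from `R ≤ 1` at `u` and `R ≥ 0` at `ψ - u`.
  have huu : u ⬝ᵥ u ≤ c := by
    have h1 := hle u
    have h2 := hnonneg (ψ - u)
    have h3 := hsymm ψ u
    rw [mulVec_sub, dotProduct_sub, sub_dotProduct, sub_dotProduct, h3, ← hu, ← hc] at h2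
    linarith
  refine ⟨fun J => u J / Real.sqrt c, ?_, ?_, ?_⟩
  · have : (fun J => u J / Real.sqrt c) ⬝ᵥ (fun J => u J / Real.sqrt c) = (u ⬝ᵥ u) / c := by
      simp only [dotProduct, Finset.sum_div]
      refine Finset.sum_congr rfl fun J _ => ?_
      rw [div_mul_div_comm, ← sq (Real.sqrt c), hsq]
    rw [this]
    exact (div_le_one hc0).2 huu
  · have : (fun J => u J / Real.sqrt c) ⬝ᵥ ψ = c / Real.sqrt c := by
      rw [hc, dotProduct_comm ψ u]
      simp only [dotProduct, Finset.sum_div]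
      exact Finset.sum_congr rfl fun J _ => by ring
    rw [this, Real.div_sqrt]
    exact Real.sqrt_le_sqrt hcα
  · obtain ⟨L, hL⟩ := exists_signVec_dotProduct_eq u
    set x := signVec d n L
    have hx := signVec_dotProduct_le_typeTwoError S L
    -- Cauchy–Schwarz for the semidefinite form `R`, applied to `x` and `ψ`; `l` is the minimiser of
    -- the form along `x - l • ψ`.
    have hcs : (x ⬝ᵥ u) ^ 2 ≤ c * (x ⬝ᵥ (R *ᵥ x)) := by
      set l := x ⬝ᵥ u / c with hl
      have h1 := hnonneg (x - l • ψ)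
      have h2 := hsymm ψ x
      rw [mulVec_sub, dotProduct_sub, sub_dotProduct, sub_dotProduct, mulVec_smul,
        dotProduct_smul, dotProduct_smul, smul_dotProduct, smul_dotProduct, h2, ← hu, ← hc] at h1
      simp only [smul_eq_mul] at h1
      have hlc : x ⬝ᵥ u = l * c := by rw [hl]; field_simp
      rw [hlc] at h1 ⊢
      nlinarith
    have hdn : (0 : ℝ) < (d : ℝ) ^ n := by positivity
    have hsum : ∑ J, |u J / Real.sqrt c| = (∑ J, |u J|) / Real.sqrt c := by
      simp [Finset.sum_div, abs_div, abs_of_pos hsc]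
    rw [hL, mul_pow, Real.sq_sqrt (by positivity)] at hcs
    rw [hsum, div_pow, hsq, div_le_iff₀ hc0]
    have h3 : (∑ J, |u J|) ^ 2 ≤ (d : ℝ) ^ n * (c * (x ⬝ᵥ (R *ᵥ x))) := by
      have := mul_le_mul_of_nonneg_left hcs hdn.le
      rwa [← mul_assoc, mul_one_div_cancel hdn.ne', one_mul] at this
    calc _ ≤ (d : ℝ) ^ n * (c * (x ⬝ᵥ (R *ᵥ x))) := h3
      _ ≤ (d : ℝ) ^ n * (c * typeTwoError S) := by gcongr
      _ = _ := by ring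

/-- Amplitudes are at most `1`, so the overlap with `ψ` is at most the `ℓ¹` norm. This crude bound
serves only to show that the optimal error is positive. -/
lemma one_sub_le_of_isTest (hp0 : ∀ i, 0 ≤ p i) (hp1 : ∑ i, p i = 1) (hd : 0 < d)
    {α : ℝ} (hα : α < 1) {S : Op d n} (hS : IsTest S) (hSα : typeOneError p S ≤ α) :
    1 - α ≤ (d : ℝ) ^ n * typeTwoError S := by
  obtain ⟨v, -, h2, h3⟩ := exists_vector_of_isTest hp0 hp1 hd hα hS hSα
  have hle1 : ∀ J : Idx d n, amplitude p n J ≤ 1 := fun J => by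
    refine Finset.prod_le_one (fun _ _ => Real.sqrt_nonneg _) fun k _ => ?_
    rw [Real.sqrt_le_one]
    exact hp1 ▸ Finset.single_le_sum (fun i _ => hp0 i) (Finset.mem_univ (J k))
  have h4 : v ⬝ᵥ amplitude p n ≤ ∑ J, |v J| :=
    Finset.sum_le_sum fun J _ => by
      calc v J * amplitude p n J ≤ |v J| * amplitude p n J :=
            mul_le_mul_of_nonneg_right (le_abs_self _) (amplitude_nonneg J)
        _ ≤ |v J| := mul_le_of_le_one_right (abs_nonneg _) (hle1 J)
  calc 1 - α = Real.sqrt (1 - α) ^ 2 := (Real.sq_sqrt (by linarith)).symm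
    _ ≤ (∑ J, |v J|) ^ 2 := pow_le_pow_left₀ (Real.sqrt_nonneg _) (h2.trans h4) 2
    _ ≤ _ := h3

/-- If a set `A` of words has probability at least `8 α`, and each of its words has probability
at most `κ`, then the type-2 error of a test of type-1 error at most `α` is at least
`P(A)² / (4 κ dⁿ)`. -/
lemma sum_weight_sq_le_of_isTest (hp0 : ∀ i, 0 ≤ p i) (hp1 : ∑ i, p i = 1) (hd : 0 < d)
    {α : ℝ} (hα0 : 0 ≤ α) (hα : α < 1) {S : Op d n} (hS : IsTest S)
    (hSα : typeOneError p S ≤ α) (A : Finset (Idx d n)) {κ : ℝ} (hκ : 0 ≤ κ)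
    (hA : ∀ J ∈ A, weight p J ≤ κ) (hPA : 8 * α ≤ ∑ J ∈ A, weight p J) :
    (∑ J ∈ A, weight p J) ^ 2 ≤ 4 * κ * ((d : ℝ) ^ n * typeTwoError S) := by
  obtain ⟨v, h1, h2, h3⟩ := exists_vector_of_isTest hp0 hp1 hd hα hS hSα
  set ψ := amplitude p n with hψ
  set P := ∑ J ∈ A, weight p J with hP
  have hP0 : 0 ≤ P := Finset.sum_nonneg fun J _ => weight_nonneg hp0 J
  have hvψ : 1 - α ≤ v ⬝ᵥ ψ := by
    refine le_trans (Real.le_sqrt_of_sq_le ?_) h2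
    nlinarith
  -- Both vectors lie in the unit ball and their overlap is at least `1 - α`, so `‖ψ - v‖² ≤ 2 - 2
  -- (1 - α)`.
  have hdist : ∑ J ∈ A, (ψ J - v J) ^ 2 ≤ 2 * α := by
    have h4 : ∑ J, (ψ J - v J) ^ 2 = ψ ⬝ᵥ ψ - 2 * (v ⬝ᵥ ψ) + v ⬝ᵥ v := by
      simp only [dotProduct, Finset.mul_sum, ← Finset.sum_sub_distrib, ← Finset.sum_add_distrib]
      exact Finset.sum_congr rfl fun J _ => by ring
    have h5 : ψ ⬝ᵥ ψ = 1 := amplitude_dotProduct_self hp0 hp1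
    calc _ ≤ ∑ J, (ψ J - v J) ^ 2 :=
          Finset.sum_le_sum_of_subset_of_nonneg (Finset.subset_univ A) fun _ _ _ => sq_nonneg _
      _ ≤ _ := by rw [h4, h5]; linarith
  have hψA : ∑ J ∈ A, ψ J ^ 2 = P := Finset.sum_congr rfl fun J _ => amplitude_sq hp0 J
  -- The constant `8` is what makes `2αP ≤ P²/4`: `v` then retains at least half of the overlap on
  -- `A`.
  have hcs : (∑ J ∈ A, (ψ J - v J) * ψ J) ^ 2 ≤ (P / 2) ^ 2 := by
    refine (Finset.sum_mul_sq_le_sq_mul_sq A _ _).trans ?_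
    rw [hψA]
    calc _ ≤ 2 * α * P := mul_le_mul_of_nonneg_right hdist hP0
      _ ≤ _ := by nlinarith
  have hcs' : ∑ J ∈ A, (ψ J - v J) * ψ J ≤ P / 2 := abs_le_of_sq_le_sq' hcs (by linarith) |>.2
  have hsplit : ∑ J ∈ A, (ψ J - v J) * ψ J = P - ∑ J ∈ A, v J * ψ J := by
    rw [← hψA, ← Finset.sum_sub_distrib]
    exact Finset.sum_congr rfl fun J _ => by ring
  have hup : ∑ J ∈ A, v J * ψ J ≤ Real.sqrt κ * ∑ J, |v J| := by
    calc _ ≤ ∑ J ∈ A, Real.sqrt κ * |v J| := by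
          refine Finset.sum_le_sum fun J hJ => ?_
          have : ψ J ≤ Real.sqrt κ := by
            refine Real.le_sqrt_of_sq_le ?_
            rw [hψ, amplitude_sq hp0]
            exact hA J hJ
          calc v J * ψ J ≤ |v J| * ψ J :=
                mul_le_mul_of_nonneg_right (le_abs_self _) (amplitude_nonneg J)
            _ ≤ |v J| * Real.sqrt κ := mul_le_mul_of_nonneg_left this (abs_nonneg _)
            _ = _ := mul_comm _ _
      _ ≤ ∑ J, Real.sqrt κ * |v J| :=
          Finset.sum_le_sum_of_subset_of_nonneg (Finset.subset_univ A) fun _ _ _ => by positivity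
      _ = _ := by rw [Finset.mul_sum]
  have hfin : P / 2 ≤ Real.sqrt κ * ∑ J, |v J| := by linarith
  have hsq := pow_le_pow_left₀ (by linarith) hfin 2
  rw [mul_pow, Real.sq_sqrt hκ] at hsq
  have := mul_le_mul_of_nonneg_left h3 hκ
  nlinarith

/-! ### An upper bound on the optimal type-2 error -/

lemma isTest_one_sub_ketBra {w : Idx d n → ℝ} (hw : w ⬝ᵥ w = 1) :
    IsTest (1 - ketBra (fun J => (w J : ℂ))) := by
  set P := ketBra (fun J => (w J : ℂ)) with hP
  have hpos : P.PosSemidef := posSemidef_vecMulVec_self_star _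
  have hidem : P * P = P := by
    have h1 : (star fun J => (w J : ℂ)) ⬝ᵥ (fun J => (w J : ℂ)) = 1 := by
      have := congrArg (Complex.ofReal) hw
      simpa [dotProduct] using this
    rw [hP, ketBra, vecMulVec_mul_vecMulVec, h1, one_smul]
  refine ⟨?_, by simpa using hpos⟩
  have h2 : (1 - P)ᴴ * (1 - P) = 1 - P := by
    rw [conjTranspose_sub, conjTranspose_one, hpos.isHermitian.eq]
    simp [mul_sub, sub_mul, hidem]
  rw [← h2]
  exact posSemidef_conjTranspose_mul_self _

/-- The projection onto the truncation of `|φ⟩^{⊗n}` to a set `A` of words of probability at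
least `1 - α` bounds the optimal type-2 error from above. -/
lemma optTypeTwoError_le (hp0 : ∀ i, 0 ≤ p i) (hp1 : ∑ i, p i = 1) {α : ℝ} (hα0 : 0 ≤ α)
    (A : Finset (Idx d n)) (hA0 : 0 < ∑ J ∈ A, weight p J)
    (hA : 1 - α ≤ ∑ J ∈ A, weight p J) :
    optTypeTwoError p n α ≤
      (∑ J ∈ A, amplitude p n J) ^ 2 / ((∑ J ∈ A, weight p J) * (d : ℝ) ^ n) := by
  set P := ∑ J ∈ A, weight p J with hP
  have hsP : 0 < Real.sqrt P := Real.sqrt_pos.2 hA0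
  have hsq : Real.sqrt P ^ 2 = P := Real.sq_sqrt hA0.le
  set w : Idx d n → ℝ := fun J => if J ∈ A then amplitude p n J / Real.sqrt P else 0 with hw
  have hww : w ⬝ᵥ w = 1 := by
    have : w ⬝ᵥ w = ∑ J ∈ A, weight p J / P := by
      simp only [dotProduct, hw]
      rw [← Finset.sum_filter_add_sum_filter_not Finset.univ (· ∈ A)]
      rw [Finset.sum_eq_zero (s := Finset.univ.filter (· ∉ A))
        fun J hJ => by simp [(Finset.mem_filter.1 hJ).2], add_zero, Finset.filter_mem_eq_inter,
        Finset.univ_inter]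
      refine Finset.sum_congr rfl fun J hJ => ?_
      rw [if_pos hJ, div_mul_div_comm, ← sq, ← sq, hsq, amplitude_sq hp0]
    rw [this, ← Finset.sum_div, div_self hA0.ne']
  have hwψ : w ⬝ᵥ amplitude p n = Real.sqrt P := by
    have : w ⬝ᵥ amplitude p n = ∑ J ∈ A, weight p J / Real.sqrt P := by
      simp only [dotProduct, hw, ite_mul, zero_mul, Finset.sum_ite_mem, Finset.univ_inter]
      refine Finset.sum_congr rfl fun J _ => ?_
      rw [← amplitude_sq hp0]
      ring
    rw [this, ← Finset.sum_div, ← hP, Real.div_sqrt]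
  have hw1 : ∑ J, |w J| = (∑ J ∈ A, amplitude p n J) / Real.sqrt P := by
    have : ∀ J, |w J| = if J ∈ A then amplitude p n J / Real.sqrt P else 0 := fun J => by
      simp only [hw]
      split_ifs
      · exact abs_of_nonneg (div_nonneg (amplitude_nonneg J) hsP.le)
      · exact abs_zero
    simp only [this, Finset.sum_ite_mem, Finset.univ_inter, Finset.sum_div]
  set S : Op d n := 1 - ketBra (fun J => (w J : ℂ)) with hS
  have hone : typeOneError p S ≤ α := by
    rw [typeOneError_eq, hS, one_sub_map_re, sub_mulVec, one_mulVec, dotProduct_sub,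
      amplitude_dotProduct_self hp0 hp1, dotProduct_ketBra_map_re_mulVec, hwψ, hsq]
    linarith
  refine ((isLeast_optTypeTwoError p n hα0).2
    ⟨S, isTest_one_sub_ketBra hww, hone, rfl⟩).trans ?_
  refine Finset.sup'_le _ _ fun L _ => ?_
  rw [phiL_eq, trace_mul_ketBra_re, hS, sub_sub_cancel, dotProduct_ketBra_map_re_mulVec,
    dotProduct_comm, ← sq_abs]
  refine (pow_le_pow_left₀ (abs_nonneg _) (abs_signVec_dotProduct_le L w) 2).trans_eq ?_
  rw [hw1, mul_pow, div_pow, hsq, Real.sq_sqrt (by positivity)]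
  rw [div_mul_div_comm, one_mul, mul_comm P]

/-! ### The tilted family -/

/-- The partition function `∑ᵢ pᵢ^{(1+s)/2}`. -/
def partitionFun (p : Fin d → ℝ) (s : ℝ) : ℝ := ∑ i, p i ^ ((1 + s) / 2)

/-- The mean of `-log pᵢ` under the tilted distribution proportional to `pᵢ^{(1+s)/2}`. -/
def tiltedSurprisal (p : Fin d → ℝ) (s : ℝ) : ℝ :=
  (∑ i, p i ^ ((1 + s) / 2) * -Real.log (p i)) / partitionFun p s

/-- The relative entropy of the tilted distribution proportional to `pᵢ^{(1+s)/2}` with respect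
to `p`. -/
def tiltedDivergence (p : Fin d → ℝ) (s : ℝ) : ℝ :=
  (1 - s) / 2 * tiltedSurprisal p s - Real.log (partitionFun p s)

lemma partitionFun_pos (hp0 : ∀ i, 0 ≤ p i) (hp1 : ∑ i, p i = 1) (s : ℝ) :
    0 < partitionFun p s := by
  obtain ⟨i, -, hi⟩ : ∃ i ∈ Finset.univ, p i ≠ 0 :=
    Finset.exists_ne_zero_of_sum_ne_zero (by rw [hp1]; exact one_ne_zero)
  exact Finset.sum_pos' (fun j _ => Real.rpow_nonneg (hp0 j) _)
    ⟨i, Finset.mem_univ i, Real.rpow_pos_of_pos ((hp0 i).lt_of_ne' hi) _⟩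

lemma exponentFun_eq (p : Fin d → ℝ) (r : ℝ) {s : ℝ} (hs : s < 1) :
    exponentFun p r s = (s * r + Real.log (partitionFun p s)) / (1 - s) := by
  have h1 : 1 - s ≠ 0 := by linarith
  have h2 : 1 - (1 + s) / 2 = (1 - s) / 2 := by ring
  rw [exponentFun, renyiEntropy, partitionFun, h2]
  field_simp

lemma sum_weight_rpow (hp0 : ∀ i, 0 ≤ p i) (n : ℕ) (θ : ℝ) :
    ∑ J : Idx d n, weight p J ^ θ = (∑ i, p i ^ θ) ^ n := by
  rw [← sum_weight (fun i => p i ^ θ) n]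
  refine Finset.sum_congr rfl fun J _ => ?_
  exact (Real.finsetProd_rpow _ _ (fun k _ => hp0 (J k)) θ).symm

lemma partitionFun_pow (hp0 : ∀ i, 0 ≤ p i) (hp1 : ∑ i, p i = 1) (n : ℕ) (s : ℝ) :
    partitionFun p s ^ n = Real.exp (n * Real.log (partitionFun p s)) := by
  rw [Real.exp_nat_mul, Real.exp_log (partitionFun_pos hp0 hp1 s)]

/-! ### Upper bound -/

/-- Exponential Markov inequality: split the weight `w` as `w^{(1-s)/2} w^{(1+s)/2}`, bound the
first factor by the threshold, and sum the second over all words. -/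
lemma sum_weight_lt_le (hp0 : ∀ i, 0 ≤ p i) (hp1 : ∑ i, p i = 1) {s : ℝ} (hs0 : 0 ≤ s)
    (hs1 : s < 1) (a : ℝ) :
    ∑ J : Idx d n with weight p J < Real.exp (-(n * a)), weight p J ≤
      Real.exp (n * (Real.log (partitionFun p s) - (1 - s) / 2 * a)) := by
  have hpt : ∀ J ∈ Finset.univ.filter (fun J : Idx d n => weight p J < Real.exp (-(n * a))),
      weight p J ≤ Real.exp (-(n * a * ((1 - s) / 2))) * weight p J ^ ((1 + s) / 2) := by
    intro J hJ
    have hJ' := (Finset.mem_filter.1 hJ).2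
    have hw := weight_nonneg hp0 J
    have h1 : weight p J = weight p J ^ ((1 - s) / 2) * weight p J ^ ((1 + s) / 2) := by
      rw [← Real.rpow_add_of_nonneg hw (by linarith) (by linarith)]
      ring_nf
      exact (Real.rpow_one _).symm
    have h2 : weight p J ^ ((1 - s) / 2) ≤ Real.exp (-(n * a * ((1 - s) / 2))) := by
      rw [← neg_mul, Real.exp_mul]
      exact Real.rpow_le_rpow hw hJ'.le (by linarith)
    calc weight p J = _ := h1
      _ ≤ _ := mul_le_mul_of_nonneg_right h2 (Real.rpow_nonneg hw _)
  refine (Finset.sum_le_sum hpt).trans ?_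
  refine (Finset.sum_le_sum_of_subset_of_nonneg (Finset.subset_univ _) fun J _ _ =>
    mul_nonneg (Real.exp_pos _).le (Real.rpow_nonneg (weight_nonneg hp0 J) _)).trans_eq ?_
  rw [← Finset.mul_sum, sum_weight_rpow hp0]
  change _ * partitionFun p s ^ n = _
  rw [partitionFun_pow hp0 hp1, ← Real.exp_add]
  ring_nf

/-- The same device on the complementary set, with `w^{1/2} = w^{-s/2} w^{(1+s)/2}`; the common
power `(1+s)/2` lets a single `s` govern both bounds. -/
lemma sum_amplitude_ge_le (hp0 : ∀ i, 0 ≤ p i) (hp1 : ∑ i, p i = 1) {s : ℝ} (hs0 : 0 ≤ s)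
    (a : ℝ) :
    ∑ J : Idx d n with ¬ weight p J < Real.exp (-(n * a)), amplitude p n J ≤
      Real.exp (n * (Real.log (partitionFun p s) + s / 2 * a)) := by
  have hpt : ∀ J ∈ Finset.univ.filter (fun J : Idx d n => ¬ weight p J < Real.exp (-(n * a))),
      amplitude p n J ≤ Real.exp (n * a * (s / 2)) * weight p J ^ ((1 + s) / 2) := by
    intro J hJ
    have hJ' := not_lt.1 (Finset.mem_filter.1 hJ).2
    have hw : 0 < weight p J := (Real.exp_pos _).trans_le hJ'
    have h1 : amplitude p n J = weight p J ^ (-(s / 2)) * weight p J ^ ((1 + s) / 2) := by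
      rw [← Real.rpow_add hw, show -(s / 2) + (1 + s) / 2 = 1 / 2 by ring, ← Real.sqrt_eq_rpow,
        ← amplitude_sq hp0, Real.sqrt_sq (amplitude_nonneg J)]
    have h2 : weight p J ^ (-(s / 2)) ≤ Real.exp (n * a * (s / 2)) := by
      have : Real.exp (n * a * (s / 2)) = Real.exp (-(n * a)) ^ (-(s / 2)) := by
        rw [← Real.exp_mul]
        ring_nf
      rw [this]
      exact Real.rpow_le_rpow_of_nonpos (Real.exp_pos _) hJ' (by linarith)
    rw [h1]
    exact mul_le_mul_of_nonneg_right h2 (Real.rpow_nonneg hw.le _)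
  refine (Finset.sum_le_sum hpt).trans ?_
  refine (Finset.sum_le_sum_of_subset_of_nonneg (Finset.subset_univ _) fun J _ _ =>
    mul_nonneg (Real.exp_pos _).le (Real.rpow_nonneg (weight_nonneg hp0 J) _)).trans_eq ?_
  rw [← Finset.mul_sum, sum_weight_rpow hp0]
  change _ * partitionFun p s ^ n = _
  rw [partitionFun_pow hp0 hp1, ← Real.exp_add]
  ring_nf

lemma optTypeTwoError_le_exp (hp0 : ∀ i, 0 ≤ p i) (hp1 : ∑ i, p i = 1) (hd : 0 < d) {r : ℝ}
    (hr : 0 < r) {s : ℝ} (hs0 : 0 ≤ s) (hs1 : s < 1) (hn : 1 ≤ n) :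
    optTypeTwoError p n (Real.exp (-(n * r))) ≤
      Real.exp (n * (2 * exponentFun p r s - Real.log d)) / (1 - Real.exp (-r)) := by
  have hn' : (1 : ℝ) ≤ n := by exact_mod_cast hn
  have hs : 1 - s ≠ 0 := by linarith
  set Λ := Real.log (partitionFun p s) with hΛ
  -- The threshold solves `Λ - (1 - s)/2 * a = -r`, so the discarded probability is at most
  -- `e^{-nr}`.
  set a := 2 * (Λ + r) / (1 - s) with ha
  set A := Finset.univ.filter (fun J : Idx d n => ¬ weight p J < Real.exp (-(n * a))) with hA
  have hsplit := Finset.sum_filter_add_sum_filter_not Finset.univ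
    (fun J : Idx d n => weight p J < Real.exp (-(n * a))) (weight p)
  rw [sum_weight, hp1, one_pow] at hsplit
  have htail := sum_weight_lt_le (n := n) hp0 hp1 hs0 hs1 a
  have he : Λ - (1 - s) / 2 * a = -r := by rw [ha]; field_simp; ring
  rw [← hΛ, he, mul_neg] at htail
  have hαr : Real.exp (-(n * r)) ≤ Real.exp (-r) := Real.exp_le_exp.2 (by nlinarith)
  have hr1 : Real.exp (-r) < 1 := Real.exp_lt_one_iff.2 (by linarith)
  have hPA : 1 - Real.exp (-(n * r)) ≤ ∑ J ∈ A, weight p J := by linarith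
  have hPA' : 1 - Real.exp (-r) ≤ ∑ J ∈ A, weight p J := by linarith
  refine (optTypeTwoError_le hp0 hp1 (Real.exp_pos _).le A (by linarith) hPA).trans ?_
  have hamp := sum_amplitude_ge_le (n := n) hp0 hp1 hs0 a
  have he2 : Λ + s / 2 * a = exponentFun p r s := by
    rw [exponentFun_eq p r hs1, ha, ← hΛ]; field_simp; ring
  rw [← hΛ, he2] at hamp
  have hdpos : (0 : ℝ) < d := by exact_mod_cast hd
  have hdn : (d : ℝ) ^ n = Real.exp (n * Real.log d) := by
    rw [Real.exp_nat_mul, Real.exp_log hdpos]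
  have hr2 : 0 < 1 - Real.exp (-r) := by linarith
  calc (∑ J ∈ A, amplitude p n J) ^ 2 / ((∑ J ∈ A, weight p J) * (d : ℝ) ^ n)
      ≤ Real.exp (n * exponentFun p r s) ^ 2 / ((1 - Real.exp (-r)) * (d : ℝ) ^ n) := by
        have h0 : 0 ≤ ∑ J ∈ A, amplitude p n J := Finset.sum_nonneg fun J _ => amplitude_nonneg J
        gcongr
    _ = _ := by
        rw [hdn, mul_sub, Real.exp_sub, ← Real.exp_nat_mul, mul_comm (1 - Real.exp (-r)),
          div_mul_eq_div_div]
        congr 3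
        push_cast
        ring

/-! ### The Chebyshev inequality for product distributions -/

lemma sum_idx_succ (F : Idx d (n + 1) → ℝ) :
    ∑ J, F J = ∑ i, ∑ J : Idx d n, F (Fin.cons i J) := by
  rw [← Fintype.sum_prod_type', ← (Fin.consEquiv fun _ => Fin d).sum_comp F]
  rfl

lemma sum_weight_mul_sum {t x : Fin d → ℝ} (ht : ∑ i, t i = 1) (hx : ∑ i, t i * x i = 0)
    (n : ℕ) : ∑ J : Idx d n, weight t J * ∑ k, x (J k) = 0 := by
  induction n with
  | zero => simp
  | succ n ih =>
    rw [sum_idx_succ]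
    have h : ∀ i, ∑ J : Idx d n, weight t (Fin.cons i J : Idx d (n + 1)) *
        ∑ k, x ((Fin.cons i J : Idx d (n + 1)) k) = t i * x i := by
      intro i
      have h1 : ∑ J : Idx d n, weight t J = 1 := by rw [sum_weight, ht, one_pow]
      calc _ = ∑ J : Idx d n, (t i * x i * weight t J + t i * (weight t J * ∑ k, x (J k))) := by
            refine Finset.sum_congr rfl fun J _ => ?_
            simp only [weight, Fin.prod_univ_succ, Fin.sum_univ_succ, Fin.cons_zero, Fin.cons_succ]
            ring
        _ = _ := by rw [Finset.sum_add_distrib, ← Finset.mul_sum, ← Finset.mul_sum, h1, ih]; ring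
    rw [Finset.sum_congr rfl fun i _ => h i, hx]

/-- Additivity of the variance: on splitting off the first letter, the cross term vanishes because
`x` is centred. -/
lemma sum_weight_mul_sum_sq {t x : Fin d → ℝ} (ht : ∑ i, t i = 1) (hx : ∑ i, t i * x i = 0)
    (n : ℕ) : ∑ J : Idx d n, weight t J * (∑ k, x (J k)) ^ 2 = n * ∑ i, t i * x i ^ 2 := by
  induction n with
  | zero => simp
  | succ n ih =>
    rw [sum_idx_succ]
    have h : ∀ i, ∑ J : Idx d n, weight t (Fin.cons i J : Idx d (n + 1)) *
        (∑ k, x ((Fin.cons i J : Idx d (n + 1)) k)) ^ 2 =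
          t i * x i ^ 2 + t i * (n * ∑ i, t i * x i ^ 2) := by
      intro i
      have h1 : ∑ J : Idx d n, weight t J = 1 := by rw [sum_weight, ht, one_pow]
      calc _ = ∑ J : Idx d n, (t i * x i ^ 2 * weight t J +
              2 * t i * x i * (weight t J * ∑ k, x (J k)) +
              t i * (weight t J * (∑ k, x (J k)) ^ 2)) := by
            refine Finset.sum_congr rfl fun J _ => ?_
            simp only [weight, Fin.prod_univ_succ, Fin.sum_univ_succ, Fin.cons_zero, Fin.cons_succ]
            ring
        _ = _ := by
            rw [Finset.sum_add_distrib, Finset.sum_add_distrib, ← Finset.mul_sum, ← Finset.mul_sum,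
              ← Finset.mul_sum, h1, ih, sum_weight_mul_sum ht hx]
            ring
    rw [Finset.sum_congr rfl fun i _ => h i, Finset.sum_add_distrib, ← Finset.sum_mul, ht]
    push_cast
    ring

lemma eventually_half_le_sum_weight {t x : Fin d → ℝ} (ht0 : ∀ i, 0 ≤ t i)
    (ht : ∑ i, t i = 1) (hx : ∑ i, t i * x i = 0) {δ : ℝ} (hδ : 0 < δ) :
    ∀ᶠ n : ℕ in atTop,
      1 / 2 ≤ ∑ J : Idx d n with |∑ k, x (J k)| ≤ n * δ, weight t J := by
  set V := ∑ i, t i * x i ^ 2 with hV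
  filter_upwards [eventually_ge_atTop (⌈2 * V / δ ^ 2⌉₊ + 1)] with n hn
  have hn1 : (1 : ℝ) ≤ n := by exact_mod_cast (Nat.le_add_left 1 _).trans hn
  have hnV : 2 * V ≤ n * δ ^ 2 := by
    rw [← div_le_iff₀ (by positivity)]
    exact (Nat.le_ceil _).trans (by exact_mod_cast (Nat.le_succ _).trans hn)
  have hsplit := Finset.sum_filter_add_sum_filter_not Finset.univ
    (fun J : Idx d n => |∑ k, x (J k)| ≤ n * δ) (weight t)
  rw [sum_weight, ht, one_pow] at hsplit
  have htail : (∑ J : Idx d n with ¬ |∑ k, x (J k)| ≤ n * δ, weight t J) * (n * δ) ^ 2 ≤ n * V := by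
    rw [hV, ← sum_weight_mul_sum_sq ht hx n, Finset.sum_mul]
    calc _ ≤ ∑ J : Idx d n with ¬ |∑ k, x (J k)| ≤ n * δ, weight t J * (∑ k, x (J k)) ^ 2 := by
          refine Finset.sum_le_sum fun J hJ => ?_
          have hJ' := not_le.1 (Finset.mem_filter.1 hJ).2
          refine mul_le_mul_of_nonneg_left ?_ (weight_nonneg ht0 J)
          rw [← sq_abs (∑ k, x (J k))]
          exact pow_le_pow_left₀ (by positivity) hJ'.le 2
      _ ≤ _ := Finset.sum_le_sum_of_subset_of_nonneg (Finset.subset_univ _) fun J _ _ =>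
          mul_nonneg (weight_nonneg ht0 J) (sq_nonneg _)
  have hpos : 0 < (n * δ) ^ 2 := by positivity
  have h2 : (∑ J : Idx d n with ¬ |∑ k, x (J k)| ≤ n * δ, weight t J) ≤ 1 / 2 := by
    rw [← le_div_iff₀ hpos] at htail
    refine htail.trans ?_
    rw [div_le_iff₀ hpos]
    nlinarith
  linarith

/-! ### Lower bound -/

/-- The words whose surprisal rate is within `δ` of the tilted mean. -/
def typicalWords (p : Fin d → ℝ) (n : ℕ) (s δ : ℝ) : Finset (Idx d n) :=
  Finset.univ.filter fun J => |∑ k, (-Real.log (p (J k)) - tiltedSurprisal p s)| ≤ n * δ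

lemma weight_eq_exp (hp0 : ∀ i, 0 ≤ p i) {J : Idx d n} (hJ : weight p J ≠ 0) (s : ℝ) :
    weight p J = Real.exp (-(n * tiltedSurprisal p s +
      ∑ k, (-Real.log (p (J k)) - tiltedSurprisal p s))) := by
  have hk : ∀ k, p (J k) ≠ 0 := fun k => Finset.prod_ne_zero_iff.1 hJ k (Finset.mem_univ k)
  have h : -(n * tiltedSurprisal p s + ∑ k, (-Real.log (p (J k)) - tiltedSurprisal p s)) =
      ∑ k, Real.log (p (J k)) := by
    simp [Finset.sum_sub_distrib]
  rw [h, Real.exp_sum]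
  exact Finset.prod_congr rfl fun k _ => (Real.exp_log ((hp0 _).lt_of_ne' (hk k))).symm

lemma weight_le_of_mem_typicalWords (hp0 : ∀ i, 0 ≤ p i) {s δ : ℝ} {J : Idx d n}
    (hJ : J ∈ typicalWords p n s δ) :
    weight p J ≤ Real.exp (-(n * (tiltedSurprisal p s - δ))) := by
  by_cases h0 : weight p J = 0
  · rw [h0]
    exact (Real.exp_pos _).le
  have hJ' := abs_le.1 (Finset.mem_filter.1 hJ).2
  rw [weight_eq_exp hp0 h0 s]
  exact Real.exp_le_exp.2 (by linarith [hJ'.1])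

/-- Change of measure: the log-likelihood ratio of the tilted law to `p` is affine in the surprisal,
so on typical words it exceeds `n D(s)` by at most `nδ`. -/
lemma tilted_le_weight_of_mem_typicalWords (hp0 : ∀ i, 0 ≤ p i) (hp1 : ∑ i, p i = 1)
    {s δ : ℝ} (hs0 : 0 ≤ s) (hs1 : s < 1) (hδ : 0 ≤ δ) {J : Idx d n}
    (hJ : J ∈ typicalWords p n s δ) :
    weight (fun i => p i ^ ((1 + s) / 2) / partitionFun p s) J *
      Real.exp (-(n * (tiltedDivergence p s + δ))) ≤ weight p J := by
  have hZ := partitionFun_pos hp0 hp1 s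
  have ht : weight (fun i => p i ^ ((1 + s) / 2) / partitionFun p s) J =
      weight p J ^ ((1 + s) / 2) * Real.exp (-(n * Real.log (partitionFun p s))) := by
    rw [Real.exp_neg, ← partitionFun_pow hp0 hp1, weight, Finset.prod_div_distrib,
      Real.finsetProd_rpow _ _ (fun k _ => hp0 (J k))]
    simp [weight, div_eq_mul_inv]
  rw [ht]
  by_cases h0 : weight p J = 0
  -- Words containing a letter of probability zero may be typical, since `Real.log 0 = 0`; their
  -- tilted weight is zero as well.
  · rw [h0, Real.zero_rpow (by linarith)]
    simp
  have hJ' := abs_le.1 (Finset.mem_filter.1 hJ).2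
  rw [weight_eq_exp hp0 h0 s, ← Real.exp_mul, ← Real.exp_add, ← Real.exp_add]
  refine Real.exp_le_exp.2 ?_
  rw [tiltedDivergence]
  set X := ∑ k, (-Real.log (p (J k)) - tiltedSurprisal p s)
  have hX : X * ((1 - s) / 2) ≤ n * δ := by
    have hnδ : 0 ≤ n * δ := by positivity
    calc X * ((1 - s) / 2) ≤ n * δ * ((1 - s) / 2) :=
          mul_le_mul_of_nonneg_right hJ'.2 (by linarith)
      _ ≤ n * δ * 1 := mul_le_mul_of_nonneg_left (by linarith) hnδ
      _ = _ := mul_one _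
  linarith

lemma eventually_le_sum_weight_typicalWords (hp0 : ∀ i, 0 ≤ p i) (hp1 : ∑ i, p i = 1)
    {s δ : ℝ} (hs0 : 0 ≤ s) (hs1 : s < 1) (hδ : 0 < δ) :
    ∀ᶠ n : ℕ in atTop, 1 / 2 * Real.exp (-(n * (tiltedDivergence p s + δ))) ≤
      ∑ J ∈ typicalWords p n s δ, weight p J := by
  have hZ := partitionFun_pos hp0 hp1 s
  have ht0 : ∀ i, 0 ≤ p i ^ ((1 + s) / 2) / partitionFun p s := fun i =>
    div_nonneg (Real.rpow_nonneg (hp0 i) _) hZ.le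
  have ht1 : ∑ i, p i ^ ((1 + s) / 2) / partitionFun p s = 1 := by
    rw [← Finset.sum_div]
    exact div_self hZ.ne'
  have hx : ∑ i, p i ^ ((1 + s) / 2) / partitionFun p s *
      (-Real.log (p i) - tiltedSurprisal p s) = 0 := by
    simp only [mul_sub, Finset.sum_sub_distrib]
    rw [← Finset.sum_mul, ht1, one_mul, sub_eq_zero, tiltedSurprisal, Finset.sum_div]
    exact Finset.sum_congr rfl fun i _ => by ring
  filter_upwards [eventually_half_le_sum_weight ht0 ht1 hx hδ] with n hn
  calc _ ≤ (∑ J ∈ typicalWords p n s δ,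
            weight (fun i => p i ^ ((1 + s) / 2) / partitionFun p s) J) *
            Real.exp (-(n * (tiltedDivergence p s + δ))) :=
        mul_le_mul_of_nonneg_right hn (Real.exp_pos _).le
    _ ≤ _ := by
        rw [Finset.sum_mul]
        exact Finset.sum_le_sum fun J hJ =>
          tilted_le_weight_of_mem_typicalWords hp0 hp1 hs0 hs1 hδ.le hJ

lemma optTypeTwoError_pos (hp0 : ∀ i, 0 ≤ p i) (hp1 : ∑ i, p i = 1) (hd : 0 < d)
    {α : ℝ} (hα0 : 0 ≤ α) (hα : α < 1) : 0 < optTypeTwoError p n α := by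
  obtain ⟨S, hS, hSα, hSb⟩ := (isLeast_optTypeTwoError p n hα0).1
  have h := one_sub_le_of_isTest hp0 hp1 hd hα hS hSα
  rw [hSb] at h
  have hdn : (0 : ℝ) < (d : ℝ) ^ n := by positivity
  exact pos_of_mul_pos_right (by linarith : 0 < (d : ℝ) ^ n * optTypeTwoError p n α) hdn.le

lemma eventually_le_log_optTypeTwoError (hp0 : ∀ i, 0 ≤ p i) (hp1 : ∑ i, p i = 1) (hd : 0 < d)
    {r s : ℝ} (hr : 0 < r) (hs0 : 0 ≤ s) (hs1 : s < 1) (hD : tiltedDivergence p s < r) {ε : ℝ}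
    (hε : 0 < ε) :
    ∀ᶠ n : ℕ in atTop,
      n * (tiltedSurprisal p s - 2 * tiltedDivergence p s - Real.log d - ε) ≤
        Real.log (optTypeTwoError p n (Real.exp (-(n * r)))) := by
  set D := tiltedDivergence p s with hDdef
  set a := tiltedSurprisal p s with ha
  -- Budget for `4δ`: `2δ` from the squared probability of `A`, `δ` from the bound on single
  -- weights, `δ` to absorb `log 16`. The margin `D + δ < r` makes that probability eventually
  -- exceed `8 e^{-nr}`.
  obtain ⟨δ, hδ, hδr, hδε⟩ : ∃ δ, 0 < δ ∧ D + δ < r ∧ 4 * δ ≤ ε := by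
    refine ⟨min ((r - D) / 2) (ε / 4), lt_min (by linarith) (by linarith), ?_, ?_⟩
    · linarith [min_le_left ((r - D) / 2) (ε / 4)]
    · linarith [min_le_right ((r - D) / 2) (ε / 4)]
  have hlin : ∀ c : ℝ, 0 < c → ∀ᶠ n : ℕ in atTop, Real.log 16 ≤ n * c := fun c hc =>
    (tendsto_natCast_atTop_atTop.atTop_mul_const hc).eventually_ge_atTop _
  filter_upwards [eventually_le_sum_weight_typicalWords hp0 hp1 hs0 hs1 hδ,
    hlin (r - (D + δ)) (by linarith), hlin δ hδ, eventually_ge_atTop 1] with n hP hn1 hn2 hn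
  have hn' : (1 : ℝ) ≤ n := by exact_mod_cast hn
  have hα : Real.exp (-(n * r)) < 1 := Real.exp_lt_one_iff.2 (by nlinarith)
  obtain ⟨S, hS, hSα, hSb⟩ :=
    (isLeast_optTypeTwoError p n (Real.exp_pos (-(n * r))).le).1
  set A := typicalWords p n s δ
  have h8 : 8 * Real.exp (-(n * r)) ≤ 1 / 2 * Real.exp (-(n * (D + δ))) := by
    have : Real.exp (Real.log 16 + -(n * r)) ≤ Real.exp (-(n * (D + δ))) :=
      Real.exp_le_exp.2 (by linarith)
    rw [Real.exp_add, Real.exp_log (by norm_num)] at this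
    linarith
  have hmain := sum_weight_sq_le_of_isTest hp0 hp1 hd (Real.exp_pos _).le hα hS hSα A
    (Real.exp_pos (-(n * (a - δ)))).le (fun J hJ => weight_le_of_mem_typicalWords hp0 hJ)
    (h8.trans hP)
  rw [hSb] at hmain
  set β := optTypeTwoError p n (Real.exp (-(n * r))) with hβ
  have hβ0 : 0 < β := optTypeTwoError_pos hp0 hp1 hd (Real.exp_pos _).le hα
  have hsq := (pow_le_pow_left₀ (by positivity) hP 2).trans hmain
  have hdpos : (0 : ℝ) < d := by exact_mod_cast hd
  have hdn : (d : ℝ) ^ n = Real.exp (n * Real.log d) := by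
    rw [Real.exp_nat_mul, Real.exp_log hdpos]
  have hβe : β = Real.exp (Real.log β) := (Real.exp_log hβ0).symm
  have h16 : Real.exp (-(2 * (n * (D + δ)))) ≤
      Real.exp (Real.log 16 + -(n * (a - δ)) + n * Real.log d + Real.log β) := by
    rw [Real.exp_add, Real.exp_add, Real.exp_add, Real.exp_log (by norm_num), Real.exp_log hβ0,
      ← hdn, show -(2 * (n * (D + δ))) = ((2 : ℕ) : ℝ) * -(n * (D + δ)) by push_cast; ring,
      Real.exp_nat_mul]
    nlinarith
  have hfin := Real.exp_le_exp.1 h16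
  have hnε : n * (4 * δ) ≤ n * ε := mul_le_mul_of_nonneg_left hδε (by linarith)
  linarith

/-! ### The optimisation over the tilting parameter -/

/-- On `s ≥ 0` the power is at least `1/2`, which avoids the discontinuity of `0 ^ θ` at `θ = 0`. -/
lemma continuousOn_rpow_tilt (x : ℝ) :
    ContinuousOn (fun s : ℝ => x ^ ((1 + s) / 2)) (Set.Ici 0) := by
  intro s hs
  have hs' : (0 : ℝ) ≤ s := hs
  have h : ContinuousAt (fun θ : ℝ => x ^ θ) ((1 + s) / 2) :=
    Real.continuousAt_const_rpow' (by linarith)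
  have h2 : ContinuousAt (fun s : ℝ => (1 + s) / 2) s := by fun_prop
  exact (ContinuousAt.comp (f := fun s : ℝ => (1 + s) / 2) h h2).continuousWithinAt

lemma continuousOn_partitionFun (p : Fin d → ℝ) : ContinuousOn (partitionFun p) (Set.Ici 0) :=
  continuousOn_finsetSum _ fun i _ => continuousOn_rpow_tilt (p i)

lemma continuousOn_log_partitionFun (hp0 : ∀ i, 0 ≤ p i) (hp1 : ∑ i, p i = 1) :
    ContinuousOn (fun s => Real.log (partitionFun p s)) (Set.Ici 0) :=
  (continuousOn_partitionFun p).log fun s _ => (partitionFun_pos hp0 hp1 s).ne'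

lemma continuousOn_tiltedSurprisal (hp0 : ∀ i, 0 ≤ p i) (hp1 : ∑ i, p i = 1) :
    ContinuousOn (tiltedSurprisal p) (Set.Ici 0) :=
  ContinuousOn.div (continuousOn_finsetSum _ fun i _ =>
    (continuousOn_rpow_tilt (p i)).mul continuousOn_const) (continuousOn_partitionFun p)
    fun s _ => (partitionFun_pos hp0 hp1 s).ne'

lemma continuousOn_tiltedDivergence (hp0 : ∀ i, 0 ≤ p i) (hp1 : ∑ i, p i = 1) :
    ContinuousOn (tiltedDivergence p) (Set.Ici 0) :=
  (ContinuousOn.mul (by fun_prop) (continuousOn_tiltedSurprisal hp0 hp1)).sub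
    (continuousOn_log_partitionFun hp0 hp1)

lemma partitionFun_one (hp1 : ∑ i, p i = 1) : partitionFun p 1 = 1 := by
  simp [partitionFun, hp1]

lemma tiltedDivergence_one (hp1 : ∑ i, p i = 1) : tiltedDivergence p 1 = 0 := by
  simp [tiltedDivergence, partitionFun_one hp1]

lemma tiltedSurprisal_sub_two_mul (p : Fin d → ℝ) (r : ℝ) {s : ℝ} (hs : s < 1) :
    tiltedSurprisal p s - 2 * tiltedDivergence p s =
      2 * exponentFun p r s - 2 * (s / (1 - s)) * (r - tiltedDivergence p s) := by
  have h1 : 1 - s ≠ 0 := by linarith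
  rw [exponentFun_eq p r hs, tiltedDivergence]
  field_simp
  ring

/-- Up to `ε`, the exponent is achieved at a tilting parameter whose divergence is below `r`. -/
lemma exists_tiltedDivergence_lt (hp0 : ∀ i, 0 ≤ p i) (hp1 : ∑ i, p i = 1) {r : ℝ} (hr : 0 < r)
    {m : ℝ} (hm : ∀ s ∈ Set.Ico (0 : ℝ) 1, m ≤ exponentFun p r s) {ε : ℝ} (hε : 0 < ε) :
    ∃ s ∈ Set.Ico (0 : ℝ) 1, tiltedDivergence p s < r ∧
      2 * m - ε < tiltedSurprisal p s - 2 * tiltedDivergence p s := by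
  have hcD := continuousOn_tiltedDivergence hp0 hp1
  by_cases h0 : tiltedDivergence p 0 < r
  · refine ⟨0, ⟨le_rfl, one_pos⟩, h0, ?_⟩
    have := hm 0 ⟨le_rfl, one_pos⟩
    rw [tiltedSurprisal_sub_two_mul p r one_pos]
    simp only [zero_div, mul_zero, zero_mul]
    linarith
  -- Take the last parameter `s₀` with `D ≥ r`; it is below `1` because `D(1) = 0`. There the
  -- correction term has the favourable sign, and every point of `(s₀, 1)` has `D < r`, so a point
  -- slightly to the right loses less than `ε`. Monotonicity of `D` is not needed.
  set K := Set.Icc (0 : ℝ) 1 ∩ tiltedDivergence p ⁻¹' Set.Ici r with hK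
  have hKc : IsCompact K := by
    refine isCompact_Icc.of_isClosed_subset ?_ Set.inter_subset_left
    exact (hcD.mono fun s hs => hs.1).preimage_isClosed_of_isClosed isClosed_Icc isClosed_Ici
  obtain ⟨s₀, ⟨⟨hs₀, hs₁⟩, hs₂⟩, hub⟩ :=
    hKc.exists_isGreatest ⟨0, ⟨le_rfl, zero_le_one⟩, not_lt.1 h0⟩
  have hs₂' : r ≤ tiltedDivergence p s₀ := hs₂
  have hlt : s₀ < 1 := by
    refine hs₁.lt_of_ne fun h => ?_
    rw [h, tiltedDivergence_one hp1] at hs₂'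
    linarith
  have hval : 2 * m ≤ tiltedSurprisal p s₀ - 2 * tiltedDivergence p s₀ := by
    have h1 := hm s₀ ⟨hs₀, hlt⟩
    have h2 : 0 ≤ s₀ / (1 - s₀) := div_nonneg hs₀ (by linarith)
    rw [tiltedSurprisal_sub_two_mul p r hlt]
    nlinarith
  have hcont : ContinuousWithinAt (fun s => tiltedSurprisal p s - 2 * tiltedDivergence p s)
      (Set.Ioi s₀) s₀ :=
    (((continuousOn_tiltedSurprisal hp0 hp1).sub (continuousOn_const.mul hcD)) s₀ hs₀).mono
      fun s hs => hs₀.trans (le_of_lt hs)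
  have hev := hcont.eventually (lt_mem_nhds (show 2 * m - ε <
    tiltedSurprisal p s₀ - 2 * tiltedDivergence p s₀ by linarith))
  obtain ⟨s, hs, hsI⟩ := (hev.and (Ioo_mem_nhdsGT hlt)).exists
  refine ⟨s, ⟨hs₀.trans hsI.1.le, hsI.2⟩, ?_, hs⟩
  by_contra hcon
  exact absurd (hub ⟨⟨hs₀.trans hsI.1.le, hsI.2.le⟩, not_lt.1 hcon⟩) (not_le.2 hsI.1)

/-- As `s → 1` the numerator `s r + Λ(s)` tends to `r > 0` while `1 - s` tends to `0` from above, so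
the function blows up and the minimum is found on a compact interval `[0, c]`. -/
lemma exists_isLeast_exponentFun (hp0 : ∀ i, 0 ≤ p i) (hp1 : ∑ i, p i = 1) {r : ℝ}
    (hr : 0 < r) : ∃ m, IsLeast (exponentFun p r '' Set.Ico (0 : ℝ) 1) m := by
  have hnum : ContinuousOn (fun s => s * r + Real.log (partitionFun p s)) (Set.Ici 0) :=
    ContinuousOn.add (by fun_prop) (continuousOn_log_partitionFun hp0 hp1)
  have hcont : ContinuousOn (exponentFun p r) (Set.Ico 0 1) := by
    refine ContinuousOn.congr (f := fun s => (s * r + Real.log (partitionFun p s)) / (1 - s)) ?_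
      fun s hs => exponentFun_eq p r hs.2
    exact (hnum.mono fun s hs => hs.1).div (by fun_prop) fun s hs => by linarith [hs.2]
  have hnum1 : Tendsto (fun s => s * r + Real.log (partitionFun p s)) (𝓝[<] 1) (𝓝 r) := by
    have h := (hnum.continuousAt (Ici_mem_nhds one_pos)).tendsto
    simp only [partitionFun_one hp1, Real.log_one, one_mul, add_zero] at h
    exact h.mono_left nhdsWithin_le_nhds
  have hinv : Tendsto (fun s : ℝ => (1 - s)⁻¹) (𝓝[<] 1) atTop := by
    refine tendsto_inv_nhdsGT_zero.comp (tendsto_nhdsWithin_iff.2 ⟨?_, ?_⟩)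
    · have : Tendsto (fun s : ℝ => 1 - s) (𝓝 1) (𝓝 (1 - 1)) :=
        (continuous_const.sub continuous_id).tendsto 1
      rw [sub_self] at this
      exact this.mono_left nhdsWithin_le_nhds
    · filter_upwards [self_mem_nhdsWithin] with s hs
      exact sub_pos.2 (Set.mem_Iio.1 hs)
  have hlim := hnum1.pos_mul_atTop hr hinv
  obtain ⟨b, hb, hbs⟩ := (mem_nhdsLT_iff_exists_Ioo_subset' (zero_lt_one' ℝ)).1
    ((hlim.eventually_ge_atTop (exponentFun p r 0)).and (Ioo_mem_nhdsLT one_pos))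
  have hb1 : b < 1 := hb
  set c := max b 0
  have hc1 : c < 1 := max_lt hb1 one_pos
  obtain ⟨s₀, hs₀, hmin⟩ := (isCompact_Icc (a := (0 : ℝ)) (b := c)).exists_isMinOn
    ⟨0, le_rfl, le_max_right _ _⟩ (hcont.mono fun s hs => ⟨hs.1, hs.2.trans_lt hc1⟩)
  refine ⟨exponentFun p r s₀, ⟨s₀, ⟨hs₀.1, hs₀.2.trans_lt hc1⟩, rfl⟩, ?_⟩
  rintro _ ⟨s, hs, rfl⟩
  by_cases hsc : s ≤ c
  · exact hmin ⟨hs.1, hsc⟩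
  · have h0 : exponentFun p r s₀ ≤ exponentFun p r 0 := hmin ⟨le_rfl, le_max_right _ _⟩
    have h1 : exponentFun p r 0 ≤ (s * r + Real.log (partitionFun p s)) * (1 - s)⁻¹ :=
      (hbs ⟨(le_max_left b 0).trans_lt (not_le.1 hsc), hs.2⟩).1
    rw [← div_eq_mul_inv, ← exponentFun_eq p r hs.2] at h1
    exact h0.trans h1

end

end CompositeTest

end

theorem mainTheorem4 (d : ℕ) (p : Fin d → ℝ) (hp0 : ∀ i, 0 ≤ p i) (hp1 : ∑ i, p i = 1)
    (hnu : ¬ ∀ i, p i = 1 / (d : ℝ)) (r : ℝ) (hr : 0 < r) :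
    (∀ n : ℕ, 1 ≤ n →
      0 < CompositeTest.optTypeTwoError p n (Real.exp (-((n : ℝ) * r)))) ∧
    ∃ m : ℝ, IsLeast (CompositeTest.exponentFun p r '' Set.Ico (0 : ℝ) 1) m ∧
      (fun n : ℕ =>
          Real.log (CompositeTest.optTypeTwoError p n (Real.exp (-((n : ℝ) * r)))) -
            (n : ℝ) * (2 * m - Real.log (d : ℝ)))
        =o[atTop] (fun n : ℕ => (n : ℝ)) := by
  have hd : 0 < d := by
    rcases Nat.eq_zero_or_pos d with rfl | h
    · simp at hp1
    · exact h
  have hpos : ∀ n : ℕ, 1 ≤ n →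
      0 < CompositeTest.optTypeTwoError p n (Real.exp (-((n : ℝ) * r))) := fun n hn =>
    CompositeTest.optTypeTwoError_pos hp0 hp1 hd (Real.exp_pos _).le
      (Real.exp_lt_one_iff.2 (by
        have : (1 : ℝ) ≤ n := by exact_mod_cast hn
        nlinarith))
  obtain ⟨m, hm⟩ := CompositeTest.exists_isLeast_exponentFun hp0 hp1 hr
  refine ⟨hpos, m, hm, isLittleO_iff.2 fun ε hε => ?_⟩
  obtain ⟨s, hs, hD, hsm⟩ := CompositeTest.exists_tiltedDivergence_lt hp0 hp1 hr
    (fun s hs => hm.2 ⟨s, hs, rfl⟩) (half_pos hε)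
  obtain ⟨s₁, hs₁, hms₁⟩ := hm.1
  have hr1 : 0 < 1 - Real.exp (-r) := sub_pos.2 (Real.exp_lt_one_iff.2 (by linarith))
  -- The normalisation of the truncated vector costs only a factor independent of `n`.
  have hconst : ∀ᶠ n : ℕ in atTop, -Real.log (1 - Real.exp (-r)) ≤ n * ε :=
    (tendsto_natCast_atTop_atTop.atTop_mul_const hε).eventually_ge_atTop _
  filter_upwards [CompositeTest.eventually_le_log_optTypeTwoError hp0 hp1 hd hr hs.1 hs.2 hD
    (half_pos hε), hconst, eventually_ge_atTop 1] with n hlow hn hn1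
  have hup := Real.log_le_log (hpos n hn1)
    (CompositeTest.optTypeTwoError_le_exp hp0 hp1 hd hr hs₁.1 hs₁.2 hn1)
  rw [Real.log_div (Real.exp_pos _).ne' hr1.ne', Real.log_exp, hms₁] at hup
  have hn0 : (0 : ℝ) ≤ n := Nat.cast_nonneg n
  rw [Real.norm_eq_abs, Real.norm_of_nonneg hn0, abs_le]
  constructor
  · nlinarith
  · linarith
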